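/- **Definitions.** Let $q\ge 2$, $V=\{1,\dots,q\}$, $X=V^n$ with the Hamming distance $d$, and $$K_{n,q,i}(x)=\sum_{j=0}^i(-1)^j(q-1)^{i-j}\binom{x}{j}\binom{n-x}{i-j}.$$ Let $E_i$ be the matrix on $X\times X$ with entries $(E_i)_{xy}=q^{-n}K_{n,q,i}(d(x,y))$ $(0\le i\le n)$, the primitive idempotents of the Hamming scheme $H(n,q)$. A nonempty $C\subseteq X$ with characteristic vector $\chi$ is a *$t$-design* in $H(n,q)$ ($t\le n$) if $\chi^\top E_i\chi=0$ for $1\le i\le t$ (equivalently, $C$ is an orthogonal array of strength $t$). A *tight $4$-design* is a $4$-design (so $n\ge4$) with $|C|=\sum_{k=0}^{2}\binom nk(q-1)^k$. A *symmetric association scheme of $D$ classes* is a finite set $Y$ with nonempty relations $R_0,\dots,R_D\subseteq Y\times Y$ whose adjacency matrices $A_i$ satisfy $A_0=I$, $\sum_iA_i=J$ (the all-one matrix), $A_i^\top=A_i$ and $A_iA_j=\sum_kp_{ij}^kA_k$ with nonnegative integers $p_{ij}^k$. Its real span $\mathcal A=\langle A_0,\dots,A_D\rangle$ has a unique basis of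 primitive idempotents, among them $E_0=\frac1{|Y|}J$. Given an ordering $E_0,E_1,\dots,E_D$ of this basis, the second eigenmatrix $Q$ and the Krein parameters $q_{ij}^k$ are defined by $E_i=\frac1{|Y|}\sum_jQ_{ji}A_j$ and $E_i\circ E_j=\frac1{|Y|}\sum_kq_{ij}^kE_k$ ($\circ$ is the entrywise product). The scheme is *$Q$-polynomial* with respect to the ordering if for each $i$ there is a polynomial $v_i^*$ of degree $i$ with $Q_{ji}=v_i^*(Q_{j1})$ for all $j$. Put $b_i^*=q_{1,i+1}^i$ $(0\le i<D)$ and $c_i^*=q_{1,i-1}^i$ $(1\le i\le D)$; the *Krein array* is $\{b_0^*,\dots,b_{D-1}^*;c_1^*,\dots,c_D^*\}$. The scheme is *$Q$-antipodal* if $b_i^*=c_{D-i}^*$ for all $0\le i<D$ except possibly $i=\lfloor D/2\rfloor$. **Theorem.** Let $q\ge2$ and let $C$ be a tight $4$-design in $H(n,q)$. Then the set of distances between distinct elements of $C$ is $\{\alpha_1,\alpha_2\}$, where $\alpha_1<\alpha_2$ are positive integers and are exactly the real zeros of $\sum_{j=0}^2K_{n,q,j}(x)$. For $1\le i\le q$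 put $C_i=\{(x_2,\dots,x_n):(i,x_2,\dots,x_n)\in C\}$, and let $\tilde C=\bigcup_{i=1}^qC_i\subseteq V^{n-1}$. Let $\tilde S_0,\tilde S_1,\tilde S_2,\tilde S_3,\tilde S_4$ be the relations on $\tilde C$ of being at Hamming distance $0,\ \alpha_1-1,\ \alpha_1,\ \alpha_2-1,\ \alpha_2$ respectively. Then $(\tilde C,\{\tilde S_i\}_{i=0}^4)$ is a symmetric association scheme of $4$ classes, and for some ordering of its primitive idempotents it is $Q$-polynomial and $Q$-antipodal with Krein array $$\{(n-1)(q-1),\,(n-2)(q-1),\,2(q-1),\,1;\ 1,\,2,\,(n-2)(q-1),\,(n-1)(q-1)\}.$$ -/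

import Mathlib

open Matrix

noncomputable section

/-! ### Symmetric association schemes -/

namespace AssocScheme

variable {X : Type*} [Fintype X] [DecidableEq X] {D : ℕ}

open Classical in
/-- The adjacency matrix of a binary relation on a finite set. -/
def adj (R : X → X → Prop) : Matrix X X ℝ :=
  Matrix.of fun x y => if R x y then 1 else 0

/-- `(X, {R₀, …, R_D})` is a symmetric association scheme of `D` classes. -/
structure IsScheme (R : Fin (D + 1) → X → X → Prop) : Prop where
  nonempty : ∀ i, ∃ x y, R i x y
  zero : adj (R 0) = 1
  sum : ∑ i, adj (R i) = Matrix.of fun _ _ => 1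
  symm : ∀ i, (adj (R i))ᵀ = adj (R i)
  mul : ∃ p : Fin (D + 1) → Fin (D + 1) → Fin (D + 1) → ℕ,
    ∀ i j, adj (R i) * adj (R j) = ∑ k, (p i j k : ℝ) • adj (R k)

/-- The real span of the adjacency matrices (the Bose–Mesner algebra, for a scheme). -/
def boseMesner (R : Fin (D + 1) → X → X → Prop) : Submodule ℝ (Matrix X X ℝ) :=
  Submodule.span ℝ (Set.range fun i => adj (R i))

/-- `E` is a primitive idempotent of the space of matrices `A`: a nonzero idempotent of `A` such
that the only idempotents `F` of `A` with `F E = E F = F` are `0` and `E`. -/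
structure IsPrimitiveIdempotent (A : Submodule ℝ (Matrix X X ℝ)) (E : Matrix X X ℝ) : Prop where
  mem : E ∈ A
  ne_zero : E ≠ 0
  idem : E * E = E
  primitive : ∀ F ∈ A, F * F = F → F * E = F → E * F = F → F = 0 ∨ F = E

/-- `E₀, …, E_D` is an ordering, starting with `E₀ = |X|⁻¹ J`, of the basis of the Bose–Mesner
algebra that consists of primitive idempotents. -/
structure IsIdempotentOrdering (R : Fin (D + 1) → X → X → Prop)
    (E : Fin (D + 1) → Matrix X X ℝ) : Prop where
  zero : E 0 = (Fintype.card X : ℝ)⁻¹ • Matrix.of fun _ _ => 1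
  primitive : ∀ i, IsPrimitiveIdempotent (boseMesner R) (E i)
  linearIndependent : LinearIndependent ℝ E
  span : Submodule.span ℝ (Set.range E) = boseMesner R

/-- `Q` is the second eigenmatrix: `E_i = |X|⁻¹ ∑_j Q_{ji} A_j`. -/
def IsSecondEigenmatrix (R : Fin (D + 1) → X → X → Prop) (E : Fin (D + 1) → Matrix X X ℝ)
    (Q : Matrix (Fin (D + 1)) (Fin (D + 1)) ℝ) : Prop :=
  ∀ i, E i = (Fintype.card X : ℝ)⁻¹ • ∑ j, Q j i • adj (R j)

/-- The scheme is `Q`-polynomial with respect to the ordering `E₀, …, E_D` of its primitive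
idempotents: `Q_{ji} = v_i(Q_{j1})` for polynomials `v_i` of degree `i`. -/
structure IsQPolynomial (R : Fin (D + 1) → X → X → Prop)
    (E : Fin (D + 1) → Matrix X X ℝ) : Prop where
  ordering : IsIdempotentOrdering R E
  polynomial : ∃ Q : Matrix (Fin (D + 1)) (Fin (D + 1)) ℝ, IsSecondEigenmatrix R E Q ∧
    ∃ v : Fin (D + 1) → Polynomial ℝ, ∀ i, (v i).degree = ((i : ℕ) : WithBot ℕ) ∧
      ∀ j, Q j i = (v i).eval (Q j 1)

/-- `κ i j k` are the Krein parameters `q_{ij}^k`, given by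
`E_i ∘ E_j = |X|⁻¹ ∑_k q_{ij}^k E_k` with the entrywise product. -/
def IsKrein (E : Fin (D + 1) → Matrix X X ℝ)
    (κ : Fin (D + 1) → Fin (D + 1) → Fin (D + 1) → ℝ) : Prop :=
  ∀ i j, E i ⊙ E j = (Fintype.card X : ℝ)⁻¹ • ∑ k, κ i j k • E k

/-- The first half `b₀*, …, b_{D-1}*` of the Krein array: `b_i* = q_{1,i+1}^i`. -/
def kreinB (κ : Fin (D + 1) → Fin (D + 1) → Fin (D + 1) → ℝ) : Fin D → ℝ :=
  fun i => κ 1 i.succ i.castSucc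

/-- The second half `c₁*, …, c_D*` of the Krein array, where `c_i* = q_{1,i-1}^i`;
the entry with index `i : Fin D` is `c_{i+1}*`. -/
def kreinC (κ : Fin (D + 1) → Fin (D + 1) → Fin (D + 1) → ℝ) : Fin D → ℝ :=
  fun i => κ 1 i.castSucc i.succ

/-- `Q`-antipodality: `b_i* = c_{D-i}*` except possibly for `i = ⌊D/2⌋`. (The index `i.rev` is
`D - 1 - i`, at which `kreinC` has the value `c_{D-i}*`.) -/
def IsQAntipodal (κ : Fin (D + 1) → Fin (D + 1) → Fin (D + 1) → ℝ) : Prop :=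
  ∀ i : Fin D, (i : ℕ) ≠ D / 2 → kreinB κ i = kreinC κ i.rev

end AssocScheme

/-! ### Hamming schemes and tight designs -/

namespace Hamming

/-- The generalized binomial coefficient `x (x - 1) ⋯ (x - k + 1) / k!`. -/
def binom (x : ℝ) (k : ℕ) : ℝ := (∏ i ∈ Finset.range k, (x - i)) / (k.factorial : ℝ)

/-- The Krawtchouk polynomial
`K_{n,q,i}(x) = ∑_{j=0}^i (-1)^j (q-1)^{i-j} binom(x, j) binom(n-x, i-j)`. -/
def krawtchouk (n q i : ℕ) (x : ℝ) : ℝ :=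
  ∑ j ∈ Finset.range (i + 1),
    (-1) ^ j * ((q : ℝ) - 1) ^ (i - j) * binom x j * binom (n - x) (i - j)

/-- The primitive idempotent `E_i = q⁻ⁿ ∑_j K_{n,q,i}(j) A_j` of the Hamming scheme `H(n,q)`,
where `A_j` is the adjacency matrix of the relation "Hamming distance `j`". -/
def idem (n q i : ℕ) : Matrix (Fin n → Fin q) (Fin n → Fin q) ℝ :=
  Matrix.of fun x y => ((q : ℝ) ^ n)⁻¹ * krawtchouk n q i (hammingDist x y)

/-- The characteristic vector of a subset of `H(n,q)`. -/
def charVec {n q : ℕ} (C : Finset (Fin n → Fin q)) : (Fin n → Fin q) → ℝ :=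
  fun x => if x ∈ C then 1 else 0

/-- `C` is a `t`-design in `H(n,q)`: a nonempty subset with `χᵀ E_i χ = 0` for `1 ≤ i ≤ t`
(where `t ≤ n`, so that these `E_i` exist). -/
structure IsDesign {n q : ℕ} (t : ℕ) (C : Finset (Fin n → Fin q)) : Prop where
  le : t ≤ n
  nonempty : C.Nonempty
  vanish : ∀ i, 1 ≤ i → i ≤ t → charVec C ⬝ᵥ (idem n q i *ᵥ charVec C) = 0

/-- `C` is a tight `2e`-design in `H(n,q)`: it attains Rao's bound. -/
structure IsTightDesign {n q : ℕ} (e : ℕ) (C : Finset (Fin n → Fin q)) : Prop where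
  design : IsDesign (2 * e) C
  card : C.card = ∑ k ∈ Finset.range (e + 1), n.choose k * (q - 1) ^ k

/-- The degree set of `C`: the distances between distinct elements of `C`. -/
def degreeSet {n q : ℕ} (C : Finset (Fin n → Fin q)) : Set ℕ :=
  {d | ∃ x ∈ C, ∃ y ∈ C, x ≠ y ∧ hammingDist x y = d}

/-- The part `C_a = {(x₂, …, x_n) | (a, x₂, …, x_n) ∈ C}`, where `n = m + 1`. -/
def part {m q : ℕ} (C : Finset (Fin (m + 1) → Fin q)) (a : Fin q) : Finset (Fin m → Fin q) :=
  Finset.univ.filter fun x => (Fin.cons a x : Fin (m + 1) → Fin q) ∈ C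

/-- The union `C̃` of the parts `C_a`. -/
def tilde {m q : ℕ} (C : Finset (Fin (m + 1) → Fin q)) : Finset (Fin m → Fin q) :=
  Finset.univ.biUnion (part C)

/-- The relations on `C̃` given by the Hamming distances `0, α₁ - 1, α₁, α₂ - 1, α₂`. -/
def tildeRel {m q : ℕ} (C : Finset (Fin (m + 1) → Fin q)) (α₁ α₂ : ℕ) :
    Fin (4 + 1) → tilde C → tilde C → Prop :=
  fun i x y => hammingDist (x : Fin m → Fin q) (y : Fin m → Fin q) =
    (![0, α₁ - 1, α₁, α₂ - 1, α₂] : Fin (4 + 1) → ℕ) i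

end Hamming

end

/-! Let φ(a,b) = qδ_{ab} - 1. By a generating function, K_i at a Hamming distance is the sum over
i-subsets S of ∏_{k∈S} φ(x_k,y_k), a positive semidefinite kernel for each S. The design condition
therefore forces every S-sum with 1 ≤ |S| ≤ 4 to vanish separately (`IsDesign.isBalanced`), and
averages of products of functions of at most four coordinates factor. So the Gram matrices of
subsets of size at most 2 are, up to the factor |C|, pairwise orthogonal idempotents
(`IsBalanced.gram_mul_gram`).

Grouping these subsets by their size off the first coordinate and by whether they contain it gives
five orthogonal idempotents. Their traces add up to Rao's bound, so tightness makes their sum the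
identity. Its off-diagonal entries say that every distance in C is a zero of K_0 + K_1 + K_2. Those
zeros ρ₁, ρ₂ satisfy 1 < ρ₁ and ρ₁ + 1 < ρ₂, so deleting the first coordinate is injective on C, and
the remaining distance determines whether the deleted coordinates agree.

Hence the five idempotents lie in the span of the five distance matrices of C̃. A dimension count
makes them a basis, which gives the scheme and also shows that no relation is empty; in particular
ρ₁ and ρ₂ are attained, hence integers. The Krein array and the dual polynomials come from a
three-term recurrence for the entries (`IsAdmissible.mul_eigenvalue`). -/

namespace AssocScheme

/-! ### Schemes from orthogonal idempotents in the span of a partition -/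

variable {X : Type*} {D : ℕ}

theorem adj_of_rel {R : X → X → Prop} {x y : X} (h : R x y) : adj R x y = 1 := by
  simp [adj, h]

theorem adj_of_not_rel {R : X → X → Prop} {x y : X} (h : ¬ R x y) : adj R x y = 0 := by
  simp [adj, h]

/-- A combination of the adjacency matrices of a partition of `X × X` is constant on each class. -/
theorem sum_smul_adj_apply {ι : Type*} [Fintype ι] {R : ι → X → X → Prop}
    (huniq : ∀ x y i j, R i x y → R j x y → i = j) (c : ι → ℝ) {x y : X} {i : ι} (h : R i x y) :
    (∑ j, c j • adj (R j)) x y = c i := by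
  classical
  rw [Matrix.sum_apply, Finset.sum_eq_single i]
  · simp [adj_of_rel h]
  · intro j _ hj
    rw [Matrix.smul_apply, adj_of_not_rel fun h' => hj (huniq x y j i h' h), smul_zero]
  · simp

/-- Matrices with the same values as a combination of adjacency matrices on every class. -/
theorem eq_sum_smul_adj {ι : Type*} [Fintype ι] {R : ι → X → X → Prop}
    (hex : ∀ x y, ∃ i, R i x y) (huniq : ∀ x y i j, R i x y → R j x y → i = j)
    {M : Matrix X X ℝ} {c : ι → ℝ} (h : ∀ x y i, R i x y → M x y = c i) :
    M = ∑ j, c j • adj (R j) := by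
  ext x y
  obtain ⟨i, hi⟩ := hex x y
  rw [sum_smul_adj_apply huniq c hi, h x y i hi]

theorem linearIndependent_of_orthogonal_idempotents [Fintype X]
    {ι : Type*} [Fintype ι] [DecidableEq ι]
    {E : ι → Matrix X X ℝ} (hne : ∀ i, E i ≠ 0)
    (horth : ∀ i j, E i * E j = if i = j then E i else 0) : LinearIndependent ℝ E := by
  rw [Fintype.linearIndependent_iff]
  intro g hg i
  have h : (∑ j, g j • E j) * E i = 0 := by rw [hg, zero_mul]
  simp only [Finset.sum_mul, smul_mul_assoc, horth, smul_ite, smul_zero, Finset.sum_ite_eq',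
    Finset.mem_univ, if_true] at h
  exact (smul_eq_zero.mp h).resolve_right (hne i)

section Idempotents

variable [Fintype X] {R : Fin (D + 1) → X → X → Prop} {E : Fin (D + 1) → Matrix X X ℝ}

/-- Dimension count: the right side is spanned by D + 1 matrices and contains D + 1 independent
ones. -/
theorem span_eq_boseMesner (hE : LinearIndependent ℝ E) (hmem : ∀ i, E i ∈ boseMesner R) :
    Submodule.span ℝ (Set.range E) = boseMesner R := by
  apply Submodule.eq_of_le_of_finrank_le
  · exact Submodule.span_le.mpr (Set.range_subset_iff.mpr hmem)
  · rw [finrank_span_eq_card hE]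
    exact finrank_range_le_card _

theorem linearIndependent_adj (hE : LinearIndependent ℝ E) (hmem : ∀ i, E i ∈ boseMesner R) :
    LinearIndependent ℝ fun i => adj (R i) := by
  rw [linearIndependent_iff_card_le_finrank_span]
  have h := finrank_span_eq_card hE
  rw [span_eq_boseMesner hE hmem] at h
  exact h.ge

theorem mul_mem_boseMesner (hE : LinearIndependent ℝ E) (hmem : ∀ i, E i ∈ boseMesner R)
    (horth : ∀ i j, E i * E j = if i = j then E i else 0) {A B : Matrix X X ℝ}
    (hA : A ∈ boseMesner R) (hB : B ∈ boseMesner R) : A * B ∈ boseMesner R := by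
  have hs := span_eq_boseMesner hE hmem
  rw [← hs, Submodule.mem_span_range_iff_exists_fun] at hA hB
  obtain ⟨a, rfl⟩ := hA
  obtain ⟨b, rfl⟩ := hB
  simp only [Finset.sum_mul, Finset.mul_sum, smul_mul_assoc, mul_smul_comm, horth]
  refine Submodule.sum_mem _ fun i _ => Submodule.smul_mem _ _ ?_
  refine Submodule.sum_mem _ fun j _ => Submodule.smul_mem _ _ ?_
  split_ifs
  · exact hmem _
  · exact Submodule.zero_mem _

/-- A partition of `X × X` into symmetric relations whose adjacency matrices span a space with a
basis of orthogonal idempotents is an association scheme. -/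
theorem isScheme_of_orthogonal_idempotents [DecidableEq X] (hex : ∀ x y, ∃ i, R i x y)
    (huniq : ∀ x y i j, R i x y → R j x y → i = j) (hzero : ∀ x y, R 0 x y ↔ x = y)
    (hsymm : ∀ i x y, R i x y → R i y x) (hne : ∀ i, E i ≠ 0)
    (hmem : ∀ i, E i ∈ boseMesner R)
    (horth : ∀ i j, E i * E j = if i = j then E i else 0) : IsScheme R := by
  classical
  have hE := linearIndependent_of_orthogonal_idempotents hne horth
  have hnonempty : ∀ i, ∃ x y, R i x y := by
    intro i
    by_contra! h
    refine (linearIndependent_adj hE hmem).ne_zero i ?_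
    ext x y
    exact adj_of_not_rel (h x y)
  refine ⟨hnonempty, ?_, ?_, ?_, ?_⟩
  · ext x y
    simp [adj, hzero, Matrix.one_apply]
  · have h := eq_sum_smul_adj (M := Matrix.of fun _ _ => (1 : ℝ)) (c := fun _ => 1) hex huniq
      (fun _ _ _ _ => rfl)
    simpa using h.symm
  · intro i
    ext x y
    have : R i y x ↔ R i x y := ⟨hsymm i y x, hsymm i x y⟩
    simp [adj, this]
  · choose u v huv using hnonempty
    -- A product known to lie in the span has as k-th coefficient its entry at any pair of class k.
    -- That entry counts points z, so the coefficients are natural numbers.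
    refine ⟨fun i j k => (Finset.univ.filter fun z => R i (u k) z ∧ R j z (v k)).card, ?_⟩
    intro i j
    have hm : adj (R i) * adj (R j) ∈ boseMesner R :=
      mul_mem_boseMesner hE hmem horth (Submodule.subset_span ⟨i, rfl⟩)
        (Submodule.subset_span ⟨j, rfl⟩)
    rw [boseMesner, Submodule.mem_span_range_iff_exists_fun] at hm
    obtain ⟨c, hc⟩ := hm
    rw [← hc]
    refine Finset.sum_congr rfl fun k _ => ?_
    congr 1
    rw [← sum_smul_adj_apply huniq c (huv k), hc, Matrix.mul_apply]
    beta_reduce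
    rw [Finset.card_filter]
    push_cast
    refine Finset.sum_congr rfl fun z _ => ?_
    by_cases h1 : R i (u k) z <;> by_cases h2 : R j z (v k) <;> simp [adj, h1, h2]

theorem isIdempotentOrdering_of_orthogonal_idempotents (hne : ∀ i, E i ≠ 0)
    (hmem : ∀ i, E i ∈ boseMesner R)
    (horth : ∀ i j, E i * E j = if i = j then E i else 0)
    (h0 : E 0 = (Fintype.card X : ℝ)⁻¹ • Matrix.of fun _ _ => 1) :
    IsIdempotentOrdering R E := by
  have hE := linearIndependent_of_orthogonal_idempotents hne horth
  have hs := span_eq_boseMesner hE hmem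
  refine ⟨h0, fun i => ⟨hmem i, hne i, by simp [horth], ?_⟩, hE, hs⟩
  intro F hF hFF hFE _
  rw [← hs, Submodule.mem_span_range_iff_exists_fun] at hF
  obtain ⟨c, rfl⟩ := hF
  have h : ∑ j, c j • E j = c i • E i := by
    rw [← hFE]
    simp [Finset.sum_mul, horth]
  rw [h] at hFF ⊢
  rw [smul_mul_smul_comm, horth, if_pos rfl, ← sub_eq_zero, ← sub_smul] at hFF
  have hc := (smul_eq_zero.mp hFF).resolve_right (hne i)
  have hc' : c i * (c i - 1) = 0 := by linarith
  rcases mul_eq_zero.mp hc' with h0 | h1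
  · left; rw [h0, zero_smul]
  · right; rw [sub_eq_zero.mp h1, one_smul]

/-- The Bose–Mesner space of a partition is closed under the entrywise product, so that the Krein
parameters exist. -/
theorem exists_isKrein [Nonempty X] (hex : ∀ x y, ∃ i, R i x y)
    (huniq : ∀ x y i j, R i x y → R j x y → i = j)
    (hE : LinearIndependent ℝ E) (hmem : ∀ i, E i ∈ boseMesner R) :
    ∃ κ, IsKrein E κ := by
  have h : ∀ i j, ∃ c : Fin (D + 1) → ℝ,
      E i ⊙ E j = (Fintype.card X : ℝ)⁻¹ • ∑ k, c k • E k := by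
    intro i j
    have hi := hmem i
    have hj := hmem j
    rw [boseMesner, Submodule.mem_span_range_iff_exists_fun] at hi hj
    obtain ⟨a, ha⟩ := hi
    obtain ⟨b, hb⟩ := hj
    have hab : E i ⊙ E j = ∑ k, (a k * b k) • adj (R k) := by
      refine eq_sum_smul_adj hex huniq fun x y k hk => ?_
      rw [Matrix.hadamard_apply, ← ha, ← hb, sum_smul_adj_apply huniq a hk,
        sum_smul_adj_apply huniq b hk]
    have hm : (Fintype.card X : ℝ) • (E i ⊙ E j) ∈ boseMesner R := by
      rw [hab]
      exact Submodule.smul_mem _ _ (Submodule.sum_mem _ fun k _ =>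
        Submodule.smul_mem _ _ (Submodule.subset_span ⟨k, rfl⟩))
    rw [← span_eq_boseMesner hE hmem, Submodule.mem_span_range_iff_exists_fun] at hm
    obtain ⟨c, hc⟩ := hm
    refine ⟨c, ?_⟩
    rw [hc, smul_smul, inv_mul_cancel₀ (Nat.cast_ne_zero.mpr Fintype.card_ne_zero), one_smul]
  choose κ hκ using h
  exact ⟨κ, hκ⟩

theorem IsKrein.eq_of_hadamard_eq [Nonempty X] {κ : Fin (D + 1) → Fin (D + 1) → Fin (D + 1) → ℝ}
    (hκ : IsKrein E κ) (hE : LinearIndependent ℝ E) {i j : Fin (D + 1)} {c : Fin (D + 1) → ℝ}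
    (h : E i ⊙ E j = (Fintype.card X : ℝ)⁻¹ • ∑ k, c k • E k) : κ i j = c := by
  rw [hκ i j] at h
  have hN : (Fintype.card X : ℝ)⁻¹ ≠ 0 :=
    inv_ne_zero (Nat.cast_ne_zero.mpr Fintype.card_ne_zero)
  have h' := smul_right_injective _ hN h
  rw [← sub_eq_zero, ← Finset.sum_sub_distrib] at h'
  simp only [← sub_smul] at h'
  funext k
  exact sub_eq_zero.mp (Fintype.linearIndependent_iff.mp hE _ h' k)

end Idempotents

end AssocScheme

/-! ### Krawtchouk polynomials as symmetric sums of kernels -/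

namespace Hamming

theorem binom_natCast (d k : ℕ) : binom (d : ℝ) k = (d.choose k : ℝ) := by
  have h : ∏ i ∈ Finset.range k, ((d : ℝ) - i) = (d.descFactorial k : ℝ) := by
    induction k with
    | zero => simp
    | succ k ih =>
      rw [Finset.prod_range_succ, ih, Nat.descFactorial_succ]
      rcases le_or_gt k d with hk | hk
      · push_cast [Nat.cast_sub hk]; ring
      · simp [Nat.descFactorial_eq_zero_iff_lt.mpr hk]
  rw [binom, h, Nat.descFactorial_eq_factorial_mul_choose, Nat.cast_mul,
    mul_div_cancel_left₀ _ (Nat.cast_ne_zero.mpr k.factorial_ne_zero)]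

theorem coeff_one_add_C_mul_X_pow (c : ℝ) (n k : ℕ) :
    ((1 + Polynomial.C c * Polynomial.X) ^ n).coeff k = c ^ k * (n.choose k : ℝ) := by
  have h : ((1 : Polynomial ℝ) + Polynomial.C c * Polynomial.X) ^ n =
      ((1 + Polynomial.X) ^ n).comp (Polynomial.C c * Polynomial.X) := by simp
  rw [h, Polynomial.comp_C_mul_X_coeff, Polynomial.coeff_one_add_X_pow, mul_comm]

/-- The kernel `q δ_{ab} - 1` on `Fin q`. -/
noncomputable def phi {q : ℕ} (a b : Fin q) : ℝ := if a = b then (q : ℝ) - 1 else -1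

variable {n q : ℕ}

theorem phi_self (a : Fin q) : phi a a = (q : ℝ) - 1 := if_pos rfl

theorem phi_of_ne {a b : Fin q} (h : a ≠ b) : phi a b = -1 := if_neg h

theorem phi_comm (a b : Fin q) : phi a b = phi b a := by simp only [phi, eq_comm]

theorem phi_eq (a b : Fin q) : phi a b = (if a = b then (q : ℝ) else 0) - 1 := by
  unfold phi; split_ifs <;> simp

theorem sum_phi (a : Fin q) : ∑ b, phi a b = 0 := by
  simp [phi_eq]

theorem sum_mul_phi (f : Fin q → ℝ) (b : Fin q) :
    ∑ a, f a * phi a b = q * f b - ∑ a, f a := by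
  simp [phi_eq, mul_sub, Finset.sum_sub_distrib, mul_comm]

theorem sum_phi_mul_phi (a b : Fin q) : ∑ c, phi a c * phi c b = q * phi a b := by
  rw [sum_mul_phi, sum_phi, sub_zero]

/-- Krawtchouk polynomials at Hamming distances as sums of products of kernels. -/
theorem krawtchouk_hammingDist (i : ℕ) (x y : Fin n → Fin q) :
    krawtchouk n q i (hammingDist x y) =
      ∑ S ∈ Finset.powersetCard i Finset.univ, ∏ k ∈ S, phi (x k) (y k) := by
  have hd : hammingDist x y ≤ n := by simpa using hammingDist_le_card_fintype (x := x) (y := y)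
  -- Generating function: the i-th coefficient on the left is the sum over i-subsets, on the right
  -- the Krawtchouk convolution.
  have hP : ∏ k, (1 + Polynomial.C (phi (x k) (y k)) * Polynomial.X) =
      (1 + Polynomial.C (-1 : ℝ) * Polynomial.X) ^ hammingDist x y *
        (1 + Polynomial.C ((q : ℝ) - 1) * Polynomial.X) ^ (n - hammingDist x y) := by
    have h1 : ∀ k, 1 + Polynomial.C (phi (x k) (y k)) * Polynomial.X =
        if x k ≠ y k then 1 + Polynomial.C (-1 : ℝ) * Polynomial.X
          else 1 + Polynomial.C ((q : ℝ) - 1) * Polynomial.X := by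
      intro k
      by_cases h : x k = y k <;> simp [phi, h]
    have hc := Finset.card_filter_add_card_filter_not (s := (Finset.univ : Finset (Fin n)))
      (fun k => x k ≠ y k)
    rw [Finset.card_univ, Fintype.card_fin] at hc
    have hc' : (Finset.univ.filter fun k => ¬ x k ≠ y k).card = n - hammingDist x y := by
      unfold hammingDist; omega
    simp only [h1]
    rw [Finset.prod_ite, Finset.prod_const, Finset.prod_const, hc']
    rfl
  have hL := congrArg (fun p => Polynomial.coeff p i) hP
  simp only [Finset.prod_one_add, Finset.prod_mul_distrib, Finset.prod_const,
    Polynomial.finsetSum_coeff, ← map_prod, Polynomial.coeff_C_mul, Polynomial.coeff_X_pow] at hL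
  rw [Polynomial.coeff_mul] at hL
  simp only [coeff_one_add_C_mul_X_pow] at hL
  rw [Finset.powersetCard_eq_filter, Finset.sum_filter, krawtchouk]
  have hL' : ∑ S ∈ (Finset.univ : Finset (Fin n)).powerset,
      (if S.card = i then ∏ k ∈ S, phi (x k) (y k) else 0) =
      ∑ S ∈ (Finset.univ : Finset (Fin n)).powerset,
        (∏ k ∈ S, phi (x k) (y k)) * if i = S.card then 1 else 0 := by
    refine Finset.sum_congr rfl fun S _ => ?_
    simp [eq_comm]
  rw [hL', hL, Finset.Nat.sum_antidiagonal_eq_sum_range_succ_mk]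
  refine Finset.sum_congr rfl fun j _ => ?_
  rw [binom_natCast, ← Nat.cast_sub hd, binom_natCast]
  ring

/-! ### Designs as balanced families, and their Gram matrices -/

/-- The sums over `Y` of all products of between `1` and `t` kernels vanish along `w`. -/
def IsBalanced {Y : Type*} [Fintype Y] (t : ℕ) (w : Y → Fin n → Fin q) : Prop :=
  ∀ S : Finset (Fin n), S.Nonempty → S.card ≤ t → ∀ a : Fin n → Fin q,
    ∑ y, ∏ k ∈ S, phi (a k) (w y k) = 0

theorem sum_prod_eq_of_subset (S : Finset (Fin n)) (f : Fin n → Fin q → ℝ) (c : ℝ) :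
    ∑ a : Fin n → Fin q, ∏ k, (if k ∈ S then f k (a k) else c) =
      (∏ k ∈ S, ∑ b, f k b) * ∏ _k ∈ Sᶜ, (q * c) := by
  have h := Finset.prod_univ_sum (fun _ : Fin n => (Finset.univ : Finset (Fin q)))
    (fun k b => if k ∈ S then f k b else c)
  rw [Fintype.piFinset_univ] at h
  rw [← h, ← Finset.prod_mul_prod_compl S]
  congr 1
  · exact Finset.prod_congr rfl fun k hk => by simp [hk]
  · exact Finset.prod_congr rfl fun k hk => by simp [Finset.mem_compl.mp hk]

theorem prod_ite_mem_const (S : Finset (Fin n)) (f : Fin n → ℝ) (c : ℝ) :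
    ∏ k, (if k ∈ S then f k else c) = (∏ k ∈ S, f k) * c ^ (Sᶜ).card := by
  rw [← Finset.prod_mul_prod_compl S, Finset.prod_congr rfl fun k hk => if_pos hk,
    Finset.prod_congr (s₁ := Sᶜ) rfl fun k hk => if_neg (Finset.mem_compl.mp hk),
    Finset.prod_const]

/-- The sum of squares identity behind the positive semidefiniteness of the idempotents. -/
theorem sum_sq_sum_prod_phi (C : Finset (Fin n → Fin q)) (S : Finset (Fin n)) :
    ∑ a : Fin n → Fin q, (∑ y ∈ C, ∏ k ∈ S, phi (a k) (y k)) ^ 2 =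
      (q : ℝ) ^ n * ∑ x ∈ C, ∑ y ∈ C, ∏ k ∈ S, phi (x k) (y k) := by
  have h : ∀ x y : Fin n → Fin q,
      ∑ a : Fin n → Fin q, (∏ k ∈ S, phi (a k) (x k)) * ∏ k ∈ S, phi (a k) (y k) =
        (q : ℝ) ^ n * ∏ k ∈ S, phi (x k) (y k) := by
    intro x y
    have h1 := sum_prod_eq_of_subset S (fun k b => phi (x k) b * phi b (y k)) 1
    simp only [prod_ite_mem_const, sum_phi_mul_phi, Finset.prod_mul_distrib, Finset.prod_const,
      one_pow, mul_one] at h1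
    calc _ = ∑ a : Fin n → Fin q,
          (∏ k ∈ S, phi (x k) (a k)) * ∏ k ∈ S, phi (a k) (y k) := by
            simp only [phi_comm]
      _ = _ := by
        rw [h1, mul_right_comm, ← pow_add, Finset.card_add_card_compl, Fintype.card_fin]
  simp only [sq, Finset.sum_mul_sum]
  rw [Finset.sum_comm, Finset.mul_sum]
  refine Finset.sum_congr rfl fun x _ => ?_
  rw [Finset.sum_comm, Finset.mul_sum]
  exact Finset.sum_congr rfl fun y _ => h x y

/-- The design condition at i only says that a sum over all i-subsets is zero. Each summand is a
positive multiple of a sum of squares over all words `a`, so each summand vanishes, and then each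
square does, also for `a` outside `C`. -/
theorem IsDesign.isBalanced {t : ℕ} {C : Finset (Fin n → Fin q)} (hq : 0 < q)
    (hC : IsDesign t C) : IsBalanced t (fun y : C => (y : Fin n → Fin q)) := by
  intro S hS hSt a
  have hq' : (0 : ℝ) < (q : ℝ) ^ n := by positivity
  have hnn : ∀ T : Finset (Fin n), 0 ≤ ∑ x ∈ C, ∑ y ∈ C, ∏ k ∈ T, phi (x k) (y k) := by
    intro T
    have h := Finset.sum_nonneg fun (a : Fin n → Fin q) (_ : a ∈ Finset.univ) =>
      sq_nonneg (∑ y ∈ C, ∏ k ∈ T, phi (a k) (y k))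
    rw [sum_sq_sum_prod_phi] at h
    exact nonneg_of_mul_nonneg_right h hq'
  have hv := hC.vanish S.card hS.card_pos hSt
  have hv' : ∑ T ∈ Finset.powersetCard S.card Finset.univ,
      ∑ x ∈ C, ∑ y ∈ C, ∏ k ∈ T, phi (x k) (y k) = 0 := by
    have h : charVec C ⬝ᵥ (idem n q S.card *ᵥ charVec C) =
        ((q : ℝ) ^ n)⁻¹ * ∑ T ∈ Finset.powersetCard S.card Finset.univ,
          ∑ x ∈ C, ∑ y ∈ C, ∏ k ∈ T, phi (x k) (y k) := by
      rw [Finset.sum_comm, Finset.mul_sum]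
      simp only [dotProduct, mulVec, charVec, ite_mul, one_mul, zero_mul, mul_ite, mul_one,
        mul_zero, Finset.sum_ite_mem, Finset.univ_inter, idem, Matrix.of_apply,
        krawtchouk_hammingDist]
      refine Finset.sum_congr rfl fun x _ => ?_
      rw [Finset.sum_comm, Finset.mul_sum]
    rw [h] at hv
    exact (mul_eq_zero.mp hv).resolve_left (inv_ne_zero hq'.ne')
  have h0 := (Finset.sum_eq_zero_iff_of_nonneg fun T _ => hnn T).mp hv' S
    (Finset.mem_powersetCard.mpr ⟨Finset.subset_univ _, rfl⟩)
  have h1 := sum_sq_sum_prod_phi C S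
  rw [h0, mul_zero, Finset.sum_eq_zero_iff_of_nonneg fun _ _ => sq_nonneg _] at h1
  have h2 := pow_eq_zero_iff (two_ne_zero) |>.mp (h1 a (Finset.mem_univ a))
  rw [← h2]
  exact Finset.sum_coe_sort C fun y => ∏ k ∈ S, phi (a k) (y k)

section Balanced

variable {Y : Type*} [Fintype Y] {w : Y → Fin n → Fin q} {t : ℕ}

/-- φ/q reproduces functions of mean zero, so the product expands into products of kernels, whose
sums vanish. -/
theorem IsBalanced.sum_prod_of_sum_eq_zero (hq : 0 < q) (hw : IsBalanced t w)
    {S : Finset (Fin n)} (hS : S.Nonempty) (hSt : S.card ≤ t) {f : Fin n → Fin q → ℝ}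
    (hf : ∀ k ∈ S, ∑ b, f k b = 0) : ∑ y, ∏ k ∈ S, f k (w y k) = 0 := by
  have hq' : (q : ℝ) ≠ 0 := by positivity
  have h : ∀ y, ∏ k ∈ S, f k (w y k) = ∑ a : Fin n → Fin q,
      ((∏ k ∈ S, (q : ℝ)⁻¹ * f k (a k)) * (q : ℝ)⁻¹ ^ (Sᶜ).card) *
        ∏ k ∈ S, phi (a k) (w y k) := by
    intro y
    have h1 := sum_prod_eq_of_subset S (fun k b => ((q : ℝ)⁻¹ * f k b) * phi b (w y k)) (q : ℝ)⁻¹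
    rw [mul_inv_cancel₀ hq', Finset.prod_const_one, mul_one] at h1
    simp only [prod_ite_mem_const] at h1
    have h2 : ∏ k ∈ S, ∑ b, ((q : ℝ)⁻¹ * f k b) * phi b (w y k) = ∏ k ∈ S, f k (w y k) := by
      refine Finset.prod_congr rfl fun k hk => ?_
      rw [sum_mul_phi, ← Finset.mul_sum, hf k hk, mul_zero, sub_zero, mul_inv_cancel_left₀ hq']
    rw [← h2, ← h1]
    refine Finset.sum_congr rfl fun a _ => ?_
    rw [Finset.prod_mul_distrib]
    ring
  simp only [h]
  rw [Finset.sum_comm]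
  refine Finset.sum_eq_zero fun a _ => ?_
  rw [← Finset.mul_sum, hw S hS hSt a, mul_zero]

/-- The average along `w` of a product of functions of at most `t` coordinates is the product of
their averages. -/
theorem IsBalanced.sum_prod (hq : 0 < q) (hw : IsBalanced t w)
    {T : Finset (Fin n)} (hT : T.card ≤ t) (f : Fin n → Fin q → ℝ) :
    ∑ y, ∏ k ∈ T, f k (w y k) =
      (Fintype.card Y : ℝ) * ∏ k ∈ T, ((q : ℝ)⁻¹ * ∑ b, f k b) := by
  have hq' : (q : ℝ) ≠ 0 := by positivity
  -- Split each factor into its deviation from the mean plus the mean; only the term without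
  -- deviations survives summation.
  have h : ∀ y, ∏ k ∈ T, f k (w y k) = ∑ S ∈ T.powerset,
      (∏ k ∈ S, (f k (w y k) - (q : ℝ)⁻¹ * ∑ b, f k b)) *
        ∏ k ∈ T \ S, ((q : ℝ)⁻¹ * ∑ b, f k b) := by
    intro y
    rw [← Finset.prod_add]
    simp
  simp only [h]
  rw [Finset.sum_comm, Finset.sum_eq_single ∅]
  · simp
  · intro S hS hne
    rw [← Finset.sum_mul]
    refine mul_eq_zero_of_left ?_ _
    refine hw.sum_prod_of_sum_eq_zero hq (Finset.nonempty_iff_ne_empty.mpr hne)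
      ((Finset.card_le_card (Finset.mem_powerset.mp hS)).trans hT)
      (f := fun k b => f k b - (q : ℝ)⁻¹ * ∑ b, f k b) fun k _ => ?_
    rw [Finset.sum_sub_distrib]
    simp [hq']
  · simp

/-- The Gram matrix of the kernels on the coordinates in `S`. -/
noncomputable def gram (w : Y → Fin n → Fin q) (S : Finset (Fin n)) : Matrix Y Y ℝ :=
  Matrix.of fun x y => ∏ k ∈ S, phi (w x k) (w y k)

/-- An entry of the product is a sum of functions of the coordinates in S ∪ T, so it factors. A
coordinate in only one of S and T contributes the mean of φ, which is zero; a common one contributes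
φ again. -/
theorem IsBalanced.gram_mul_gram (hq : 0 < q) (hw : IsBalanced t w) {S T : Finset (Fin n)}
    (hST : S.card + T.card ≤ t) :
    gram w S * gram w T = if S = T then (Fintype.card Y : ℝ) • gram w S else 0 := by
  have hq' : (q : ℝ) ≠ 0 := by positivity
  ext x y
  have hU : (S ∪ T).card ≤ t := (Finset.card_union_le S T).trans hST
  have h := hw.sum_prod hq hU fun k b =>
    (if k ∈ S then phi (w x k) b else 1) * (if k ∈ T then phi b (w y k) else 1)
  have h1 : ∀ z, ∏ k ∈ S ∪ T, ((if k ∈ S then phi (w x k) (w z k) else 1) *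
      (if k ∈ T then phi (w z k) (w y k) else 1)) =
        (∏ k ∈ S, phi (w x k) (w z k)) * ∏ k ∈ T, phi (w z k) (w y k) := by
    intro z
    rw [Finset.prod_mul_distrib, Finset.prod_ite_mem, Finset.prod_ite_mem,
      Finset.union_inter_cancel_left, Finset.union_inter_cancel_right]
  simp only [h1] at h
  rw [Matrix.mul_apply]
  simp only [gram, Matrix.of_apply]
  rw [h]
  split_ifs with hS
  · subst hS
    simp only [Finset.union_self, Matrix.smul_apply, Matrix.of_apply, smul_eq_mul]
    congr 1
    refine Finset.prod_congr rfl fun k hk => ?_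
    simp only [hk, if_true]
    rw [sum_phi_mul_phi, inv_mul_cancel_left₀ hq']
  · have : ∃ k ∈ S ∪ T, ¬ (k ∈ S ∧ k ∈ T) := by
      by_contra! hc
      apply hS
      ext k
      exact ⟨fun hk => (hc k (Finset.mem_union_left _ hk)).2,
        fun hk => (hc k (Finset.mem_union_right _ hk)).1⟩
    obtain ⟨k, hk, hk'⟩ := this
    rw [Finset.prod_eq_zero hk, mul_zero]
    · rfl
    · by_cases hkS : k ∈ S
      · have hkT : k ∉ T := fun h => hk' ⟨hkS, h⟩
        simp [hkS, hkT, sum_phi]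
      · have hkT : k ∈ T := (Finset.mem_union.mp hk).resolve_left hkS
        simp [hkS, hkT, phi_comm _ (w y k), sum_phi]

end Balanced

end Hamming

/-! ### Splitting off the first coordinate: five idempotents and the effect of tightness -/

namespace Hamming

variable {m q : ℕ}

theorem hammingDist_eq_add_tail (x y : Fin (m + 1) → Fin q) :
    hammingDist x y = (if x 0 = y 0 then 0 else 1) + hammingDist (Fin.tail x) (Fin.tail y) := by
  simp only [hammingDist]
  rw [Finset.card_filter, Finset.card_filter, Fin.sum_univ_succ]
  congr 1
  split_ifs <;> simp_all

theorem krawtchouk_zero (n q : ℕ) (x : ℝ) : krawtchouk n q 0 x = 1 := by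
  simp [krawtchouk, binom]

theorem krawtchouk_one (n q : ℕ) (x : ℝ) : krawtchouk n q 1 x = n * ((q : ℝ) - 1) - q * x := by
  simp [krawtchouk, binom, Finset.sum_range_succ]
  ring

theorem krawtchouk_two (n q : ℕ) (x : ℝ) : krawtchouk n q 2 x =
    ((n * ((q : ℝ) - 1) - q * x) ^ 2 - ((q : ℝ) - 2) * (n * ((q : ℝ) - 1) - q * x) -
      n * ((q : ℝ) - 1)) / 2 := by
  simp [krawtchouk, binom, Finset.sum_range_succ, Finset.prod_range_succ]
  ring

/-- The subset of `Fin (m + 1)` with the part `S` off `0`, containing `0` if and only if `c`. -/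
def extend (c : Bool) (S : Finset (Fin m)) : Finset (Fin (m + 1)) :=
  if c then insert 0 (S.map (Fin.succEmb m)) else S.map (Fin.succEmb m)

theorem zero_notMem_map_succEmb (S : Finset (Fin m)) :
    (0 : Fin (m + 1)) ∉ S.map (Fin.succEmb m) := by
  simp [Fin.succ_ne_zero]

theorem zero_mem_extend {c : Bool} {S : Finset (Fin m)} : 0 ∈ extend c S ↔ c = true := by
  cases c <;> simp [extend, Fin.succ_ne_zero]

theorem succ_mem_extend {c : Bool} {S : Finset (Fin m)} {k : Fin m} :
    k.succ ∈ extend c S ↔ k ∈ S := by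
  cases c <;> simp [extend, Fin.succ_ne_zero]

theorem extend_inj {c c' : Bool} {S S' : Finset (Fin m)} :
    extend c S = extend c' S' ↔ c = c' ∧ S = S' := by
  refine ⟨fun h => ⟨?_, ?_⟩, fun h => by rw [h.1, h.2]⟩
  · have := zero_mem_extend (c := c) (S := S)
    rw [h, zero_mem_extend] at this
    cases c <;> cases c' <;> simp_all
  · ext k
    rw [← succ_mem_extend (c := c), h, succ_mem_extend]

theorem card_extend (c : Bool) (S : Finset (Fin m)) : (extend c S).card = c.toNat + S.card := by
  cases c
  · simp [extend]
  · simp [extend, Finset.card_insert_of_notMem (zero_notMem_map_succEmb S), add_comm]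

theorem prod_extend (c : Bool) (S : Finset (Fin m)) (f : Fin (m + 1) → ℝ) :
    ∏ k ∈ extend c S, f k = (if c then f 0 else 1) * ∏ k ∈ S, f k.succ := by
  cases c
  · simp [extend]
  · simp [extend, Finset.prod_insert (zero_notMem_map_succEmb S)]

variable {Y : Type*} {w : Y → Fin (m + 1) → Fin q}

/-- The sum of the Gram matrices over the `r`-subsets off the first coordinate, extended by the
first coordinate if `c`. -/
noncomputable def blockGram (w : Y → Fin (m + 1) → Fin q) (c : Bool) (r : ℕ) : Matrix Y Y ℝ :=
  ∑ S ∈ Finset.powersetCard r Finset.univ, gram w (extend c S)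

theorem blockGram_apply (c : Bool) (r : ℕ) (x y : Y) : blockGram w c r x y =
    (if c then phi (w x 0) (w y 0) else 1) *
      krawtchouk m q r (hammingDist (Fin.tail (w x)) (Fin.tail (w y))) := by
  rw [krawtchouk_hammingDist, Finset.mul_sum, blockGram, Matrix.sum_apply]
  refine Finset.sum_congr rfl fun S _ => ?_
  rw [gram, Matrix.of_apply, prod_extend]
  rfl

variable [Fintype Y]

theorem IsBalanced.blockGram_mul_blockGram {t : ℕ} (hq : 0 < q) (hw : IsBalanced t w)
    {c c' : Bool} {r r' : ℕ} (h : c.toNat + r + (c'.toNat + r') ≤ t) :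
    blockGram w c r * blockGram w c' r' =
      if c = c' ∧ r = r' then (Fintype.card Y : ℝ) • blockGram w c r else 0 := by
  have h1 : ∀ S ∈ Finset.powersetCard r (Finset.univ : Finset (Fin m)),
      ∀ S' ∈ Finset.powersetCard r' (Finset.univ : Finset (Fin m)),
      gram w (extend c S) * gram w (extend c' S') =
        if c = c' ∧ S = S' then (Fintype.card Y : ℝ) • gram w (extend c S) else 0 := by
    intro S hS S' hS'
    rw [Finset.mem_powersetCard] at hS hS'
    rw [hw.gram_mul_gram hq (by rw [card_extend, card_extend, hS.2, hS'.2]; exact h)]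
    simp only [extend_inj]
  rw [blockGram, blockGram, Finset.sum_mul_sum,
    Finset.sum_congr rfl fun S hS => Finset.sum_congr rfl fun S' hS' => h1 S hS S' hS']
  split_ifs with hc
  · obtain ⟨rfl, rfl⟩ := hc
    rw [Finset.smul_sum]
    refine Finset.sum_congr rfl fun S hS => ?_
    simp [hS]
  · refine Finset.sum_eq_zero fun S hS => Finset.sum_eq_zero fun S' hS' => if_neg ?_
    rintro ⟨rfl, rfl⟩
    rw [Finset.mem_powersetCard] at hS hS'
    exact hc ⟨rfl, hS.2.symm.trans hS'.2⟩

/-- The five idempotents attached to a tight `4`-design. -/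
noncomputable def tightIdem (w : Y → Fin (m + 1) → Fin q) (i : Fin (4 + 1)) : Matrix Y Y ℝ :=
  (Fintype.card Y : ℝ)⁻¹ •
    blockGram w ((![false, false, false, true, true] : Fin (4 + 1) → Bool) i)
      ((![0, 1, 2, 1, 0] : Fin (4 + 1) → ℕ) i)

/-- The entries of the idempotents, up to a scalar, as functions of the value `k` of the first
eigenvector and the value `b` of the kernel on the first coordinate. -/
noncomputable def eigenvalue (μ s k b : ℝ) : Fin (4 + 1) → ℝ :=
  ![1, k, (k ^ 2 - (s - 1) * k - μ * s) / 2, b * k, b]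

theorem tightIdem_apply (i : Fin (4 + 1)) (x y : Y) : tightIdem w i x y =
    (Fintype.card Y : ℝ)⁻¹ * eigenvalue m ((q : ℝ) - 1)
      (m * ((q : ℝ) - 1) - q * hammingDist (Fin.tail (w x)) (Fin.tail (w y)))
      (phi (w x 0) (w y 0)) i := by
  rw [tightIdem, Matrix.smul_apply, blockGram_apply, smul_eq_mul]
  congr 1
  have h2 : (q : ℝ) - 1 - 1 = q - 2 := by ring
  fin_cases i <;>
    simp [eigenvalue, krawtchouk_zero, krawtchouk_one, krawtchouk_two, h2]

theorem IsBalanced.tightIdem_mul_tightIdem [Nonempty Y] (hq : 0 < q) (hw : IsBalanced 4 w)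
    (i j : Fin (4 + 1)) :
    tightIdem w i * tightIdem w j = if i = j then tightIdem w i else 0 := by
  have hN : (Fintype.card Y : ℝ) ≠ 0 := Nat.cast_ne_zero.mpr Fintype.card_ne_zero
  -- All five blocks use subsets of size at most 2, so strength 4 covers every pairwise product.
  have hle : ∀ i : Fin (4 + 1), ((![false, false, false, true, true] : Fin (4 + 1) → Bool) i).toNat +
      (![0, 1, 2, 1, 0] : Fin (4 + 1) → ℕ) i ≤ 2 := by decide
  have hinj : ∀ i j : Fin (4 + 1),
      ((![false, false, false, true, true] : Fin (4 + 1) → Bool) i =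
        (![false, false, false, true, true] : Fin (4 + 1) → Bool) j ∧
      (![0, 1, 2, 1, 0] : Fin (4 + 1) → ℕ) i = (![0, 1, 2, 1, 0] : Fin (4 + 1) → ℕ) j) ↔
        i = j := by decide
  rw [tightIdem, tightIdem, smul_mul_smul_comm,
    hw.blockGram_mul_blockGram hq (add_le_add (hle i) (hle j))]
  simp only [hinj]
  split_ifs
  · rw [smul_smul, mul_assoc, inv_mul_cancel₀ hN, mul_one]
  · rw [smul_zero]

theorem sum_eigenvalue (μ s k b : ℝ) : ∑ i, eigenvalue μ s k b i =
    (1 + b) * (1 + k) + (k ^ 2 - (s - 1) * k - μ * s) / 2 := by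
  simp [eigenvalue, Fin.sum_univ_succ]
  ring

/-- 1 - P is again a symmetric idempotent, so its trace is its squared Frobenius norm. -/
theorem eq_one_of_isSymm_of_idempotent_of_trace [DecidableEq Y] {P : Matrix Y Y ℝ} (hs : Pᵀ = P)
    (hi : P * P = P) (ht : P.trace = Fintype.card Y) : P = 1 := by
  have h : (1 - P) * (1 - P)ᴴ = 1 - P := by
    rw [conjTranspose_eq_transpose_of_trivial, transpose_sub, transpose_one, hs]
    exact IsIdempotentElem.one_sub hi
  have h0 : ((1 - P) * (1 - P)ᴴ).trace = 0 := by
    rw [h, trace_sub, trace_one, ht, sub_self]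
  rw [trace_mul_conjTranspose_self_eq_zero_iff] at h0
  exact (sub_eq_zero.mp h0).symm

/-- The sum of Krawtchouk polynomials at the distance of distinct members of a tight design
vanishes. -/
theorem IsBalanced.sum_krawtchouk_hammingDist [Nonempty Y] (hq : 0 < q) (hw : IsBalanced 4 w)
    (hcard : Fintype.card Y = ∑ k ∈ Finset.range 3, (m + 1).choose k * (q - 1) ^ k)
    {x y : Y} (hxy : x ≠ y) :
    ∑ j ∈ Finset.range 3, krawtchouk (m + 1) q j (hammingDist (w x) (w y)) = 0 := by
  classical
  have hN : (Fintype.card Y : ℝ) ≠ 0 := Nat.cast_ne_zero.mpr Fintype.card_ne_zero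
  have hN' : (Fintype.card Y : ℝ) = 1 + (m + 1) * ((q : ℝ) - 1) +
      (m + 1) * m / 2 * ((q : ℝ) - 1) ^ 2 := by
    rw [hcard]
    have h2 : ((m + 1).choose 2 : ℝ) = (m + 1) * m / 2 := by
      rw [Nat.cast_choose_two]; push_cast; ring
    simp only [Finset.sum_range_succ, Finset.range_zero, Finset.sum_empty]
    push_cast [h2, Nat.cast_sub hq]
    simp
  -- Tightness enters here: the constant diagonal of |Y| times the sum equals Rao's bound, so the
  -- trace is |Y|.
  have hP : ∑ i, tightIdem w i = 1 := by
    apply eq_one_of_isSymm_of_idempotent_of_trace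
    · ext x y
      simp only [Matrix.transpose_apply, Matrix.sum_apply, tightIdem_apply,
        hammingDist_comm (Fin.tail (w y)), phi_comm (w y 0)]
    · simp [Finset.sum_mul_sum, hw.tightIdem_mul_tightIdem hq]
    · simp only [Matrix.trace, Matrix.diag_apply, Matrix.sum_apply, tightIdem_apply,
        ← Finset.mul_sum, sum_eigenvalue, hammingDist_self, phi_self, Finset.sum_const,
        Finset.card_univ, nsmul_eq_mul]
      rw [inv_mul_cancel_left₀ hN, hN']
      push_cast
      ring
  have h := congrFun (congrFun hP x) y
  rw [Matrix.one_apply_ne hxy] at h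
  simp only [Matrix.sum_apply, tightIdem_apply, ← Finset.mul_sum, sum_eigenvalue] at h
  have h' := (mul_eq_zero.mp h).resolve_left (inv_ne_zero hN)
  rw [← h', hammingDist_eq_add_tail (w x) (w y)]
  simp only [Finset.sum_range_succ, Finset.range_zero, Finset.sum_empty, krawtchouk_zero,
    krawtchouk_one, krawtchouk_two, phi]
  split_ifs <;> push_cast <;> ring

/-- The sum of the first three Krawtchouk polynomials has two real zeros greater than `1` that
are more than `1` apart. -/
theorem exists_zeros_sum_krawtchouk (hm : 2 ≤ m) (hq : 2 ≤ q) :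
    ∃ ρ₁ ρ₂ : ℝ, 1 < ρ₁ ∧ ρ₁ + 1 < ρ₂ ∧ ∀ x : ℝ,
      ∑ j ∈ Finset.range 3, krawtchouk (m + 1) q j x =
        (q : ℝ) ^ 2 / 2 * ((x - ρ₁) * (x - ρ₂)) := by
  have hm' : (2 : ℝ) ≤ m := by exact_mod_cast hm
  have hq' : (2 : ℝ) ≤ q := by exact_mod_cast hq
  have hq0 : (q : ℝ) ≠ 0 := by positivity
  -- After squaring, both bounds on √Δ below reduce to this inequality. The lower one separates the
  -- zeros by more than 1, the upper one keeps them above 1.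
  have hms : 0 < ((m : ℝ) - 1) * ((q : ℝ) - 1) := mul_pos (by linarith) (by linarith)
  set Δ : ℝ := 4 * m * ((q : ℝ) - 1) + ((q : ℝ) - 2) ^ 2 with hΔ
  have hΔq : (q : ℝ) ^ 2 < Δ := by rw [hΔ]; linarith
  have hr : √Δ ^ 2 = Δ := Real.sq_sqrt ((sq_nonneg _).trans hΔq.le)
  have hqr : (q : ℝ) < √Δ := Real.lt_sqrt_of_sq_lt hΔq
  have hrB : √Δ < 2 * m * ((q : ℝ) - 1) - q + 2 := by
    rw [Real.sqrt_lt' (by nlinarith)]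
    have h1 : 0 < (m : ℝ) * ((q : ℝ) - 1) * (((m : ℝ) - 1) * ((q : ℝ) - 1)) :=
      mul_pos (mul_pos (by linarith) (by linarith)) hms
    rw [hΔ]
    linarith
  refine ⟨1 + (2 * m * ((q : ℝ) - 1) - q + 2 - √Δ) / (2 * q),
    1 + (2 * m * ((q : ℝ) - 1) - q + 2 + √Δ) / (2 * q), ?_, ?_, ?_⟩
  · have : 0 < (2 * m * ((q : ℝ) - 1) - q + 2 - √Δ) / (2 * q) :=
      div_pos (by linarith) (by linarith)
    linarith
  · have h1 : 1 < √Δ / q := (one_lt_div (by linarith)).mpr hqr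
    have h2 : (2 * m * ((q : ℝ) - 1) - q + 2 + √Δ) / (2 * q) -
        (2 * m * ((q : ℝ) - 1) - q + 2 - √Δ) / (2 * q) = √Δ / q := by field_simp; ring
    linarith
  · intro x
    simp only [Finset.sum_range_succ, Finset.range_zero, Finset.sum_empty, krawtchouk_zero,
      krawtchouk_one, krawtchouk_two]
    have h1 : (q : ℝ) ^ 2 / 2 *
        ((x - (1 + (2 * m * ((q : ℝ) - 1) - q + 2 - √Δ) / (2 * q))) *
          (x - (1 + (2 * m * ((q : ℝ) - 1) - q + 2 + √Δ) / (2 * q)))) =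
        ((2 * q * (x - 1) - (2 * m * ((q : ℝ) - 1) - q + 2)) ^ 2 - √Δ ^ 2) / 8 := by
      field_simp
      ring
    rw [h1, hr, hΔ]
    push_cast
    ring

end Hamming

/-! ### The three-term recurrence and the dual polynomials -/

namespace Hamming

open AssocScheme

/-- The values of `k` and `b` that occur on a tight `4`-design. -/
def IsAdmissible (μ s k b : ℝ) : Prop :=
  (b = -1 ∧ k ^ 2 - (s - 1) * k - μ * s = 0) ∨
    (b = s ∧ k ^ 2 - (s - 1) * k - μ * s = -2 * (s + 1) * (1 + k)) ∨ (b = s ∧ k = μ * s)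

/-- The tridiagonal matrix of the Krein parameters `q_{1,i}^l`. -/
def kreinMatrix (μ s : ℝ) : Fin (4 + 1) → Fin (4 + 1) → ℝ :=
  ![![0, 1, 0, 0, 0], ![μ * s, s - 1, 2, 0, 0],
    ![0, (μ - 1) * s, μ * s - 2 * s - 2, (μ - 1) * s, 0], ![0, 0, 2 * s, s - 1, μ * s],
    ![0, 0, 0, 1, 0]]

theorem IsAdmissible.mul_eigenvalue {μ s k b : ℝ} (h : IsAdmissible μ s k b) (i : Fin (4 + 1)) :
    k * eigenvalue μ s k b i = ∑ l, kreinMatrix μ s i l * eigenvalue μ s k b l := by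
  -- Rows 0, 1 and 4 of the recurrence are identities in k and b. Only row 2 (`hc`) and row 3 (`hd`)
  -- use admissibility.
  have hc : (k - (μ * s - 2 * s - 2)) * (k ^ 2 - (s - 1) * k - μ * s) =
      2 * (μ - 1) * s * k * (1 + b) := by
    rcases h with ⟨rfl, h⟩ | ⟨rfl, h⟩ | ⟨rfl, rfl⟩
    · rw [h]; ring
    · rw [h]; linear_combination (-2 * (b + 1)) * h
    · ring
  have hd : (k ^ 2 - (s - 1) * k - μ * s) * (b - s) = 0 := by
    rcases h with ⟨_, h⟩ | ⟨rfl, _⟩ | ⟨rfl, _⟩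
    · rw [h, zero_mul]
    · rw [sub_self, mul_zero]
    · rw [sub_self, mul_zero]
  fin_cases i <;> simp [eigenvalue, kreinMatrix, Fin.sum_univ_succ]
  · ring
  · linear_combination hc / 2
  · linear_combination hd
  · ring

/-- The polynomials expressing the dual eigenvalues through the first one. -/
noncomputable def dualPolynomial (μ s : ℝ) : Fin (4 + 1) → Polynomial ℝ :=
  let v₂ := Polynomial.C (1 / 2) * Polynomial.X ^ 2 + Polynomial.C (-(s - 1) / 2) * Polynomial.X +
    Polynomial.C (-(μ * s) / 2)
  let v₃ := Polynomial.C ((μ - 1) * s)⁻¹ *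
    ((Polynomial.X - Polynomial.C (μ * s - 2 * s - 2)) * v₂ -
      Polynomial.C ((μ - 1) * s) * Polynomial.X)
  let v₄ := Polynomial.C (μ * s)⁻¹ *
    ((Polynomial.X - Polynomial.C (s - 1)) * v₃ - Polynomial.C (2 * s) * v₂)
  ![1, Polynomial.X, v₂, v₃, v₄]

/-- From v₂ on, each recurrence step multiplies by a monic linear factor and divides by c₃* = (μ -
1)s or c₄* = μs; these are nonzero, so the degree rises by exactly one. -/
theorem degree_dualPolynomial {μ s : ℝ} (hμ : 1 < μ) (hs : 0 < s) (i : Fin (4 + 1)) :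
    (dualPolynomial μ s i).degree = ((i : ℕ) : WithBot ℕ) := by
  have h1 : ((μ - 1) * s)⁻¹ ≠ 0 := inv_ne_zero (mul_pos (by linarith) hs).ne'
  have h2 : (μ * s)⁻¹ ≠ 0 := inv_ne_zero (mul_pos (by linarith) hs).ne'
  have d2 : (Polynomial.C (1 / 2) * Polynomial.X ^ 2 +
      Polynomial.C (-(s - 1) / 2) * Polynomial.X + Polynomial.C (-(μ * s) / 2)).degree = 2 :=
    Polynomial.degree_quadratic (by norm_num)
  set v₂ := Polynomial.C (1 / 2) * Polynomial.X ^ 2 +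
      Polynomial.C (-(s - 1) / 2) * Polynomial.X + Polynomial.C (-(μ * s) / 2) with hv₂
  have d3 : (Polynomial.C ((μ - 1) * s)⁻¹ *
      ((Polynomial.X - Polynomial.C (μ * s - 2 * s - 2)) * v₂ -
        Polynomial.C ((μ - 1) * s) * Polynomial.X)).degree = 3 := by
    have d : ((Polynomial.X - Polynomial.C (μ * s - 2 * s - 2)) * v₂).degree = 3 := by
      rw [Polynomial.degree_mul, Polynomial.degree_X_sub_C, d2]; rfl
    rw [Polynomial.degree_C_mul h1, Polynomial.degree_sub_eq_left_of_degree_lt, d]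
    rw [d]
    exact (Polynomial.degree_C_mul_X_le _).trans_lt (by decide)
  set v₃ := Polynomial.C ((μ - 1) * s)⁻¹ *
      ((Polynomial.X - Polynomial.C (μ * s - 2 * s - 2)) * v₂ -
        Polynomial.C ((μ - 1) * s) * Polynomial.X) with hv₃
  have d4 : (Polynomial.C (μ * s)⁻¹ *
      ((Polynomial.X - Polynomial.C (s - 1)) * v₃ - Polynomial.C (2 * s) * v₂)).degree = 4 := by
    have d : ((Polynomial.X - Polynomial.C (s - 1)) * v₃).degree = 4 := by
      rw [Polynomial.degree_mul, Polynomial.degree_X_sub_C, d3]; rfl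
    rw [Polynomial.degree_C_mul h2, Polynomial.degree_sub_eq_left_of_degree_lt, d]
    rw [d, Polynomial.degree_C_mul (by positivity), d2]
    decide
  fin_cases i
  · exact Polynomial.degree_one
  · exact Polynomial.degree_X
  · exact d2
  · exact d3
  · exact d4

theorem IsAdmissible.eval_dualPolynomial {μ s k b : ℝ} (h : IsAdmissible μ s k b) (hμ : 1 < μ)
    (hs : 0 < s) (i : Fin (4 + 1)) : eigenvalue μ s k b i = (dualPolynomial μ s i).eval k := by
  have h1 : (μ - 1) * s ≠ 0 := (mul_pos (by linarith) hs).ne'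
  have h2 : μ * s ≠ 0 := (mul_pos (by linarith) hs).ne'
  have e2 := h.mul_eigenvalue 2
  have e3 := h.mul_eigenvalue 3
  simp [eigenvalue, kreinMatrix, Fin.sum_univ_succ] at e2 e3
  have e2' : b * k = ((μ - 1) * s)⁻¹ * ((k - (μ * s - 2 * s - 2)) *
      (1 / 2 * k ^ 2 + -(s - 1) / 2 * k + -(μ * s) / 2) - (μ - 1) * s * k) := by
    rw [eq_inv_mul_iff_mul_eq₀ h1]
    linear_combination -e2
  fin_cases i
  · simp [eigenvalue, dualPolynomial]
  · simp [eigenvalue, dualPolynomial]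
  · simp [eigenvalue, dualPolynomial]
    ring
  · simp only [eigenvalue, dualPolynomial, Fin.reduceFinMk, Matrix.cons_val, Polynomial.eval_mul,
      Polynomial.eval_C, Polynomial.eval_sub, Polynomial.eval_X, Polynomial.eval_add,
      Polynomial.eval_pow]
    exact e2'
  · simp only [eigenvalue, dualPolynomial, Fin.reduceFinMk, Matrix.cons_val, Polynomial.eval_mul,
      Polynomial.eval_C, Polynomial.eval_sub, Polynomial.eval_X, Polynomial.eval_add,
      Polynomial.eval_pow]
    rw [← e2', eq_inv_mul_iff_mul_eq₀ h2]
    linear_combination -e3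

/-- The distances between tails in a tight `4`-design whose distances are `ρ₁` and `ρ₂`. -/
def tailDist (ρ₁ ρ₂ : ℝ) : Fin (4 + 1) → ℝ := ![0, ρ₁ - 1, ρ₁, ρ₂ - 1, ρ₂]

/-- The values of the kernel on the first coordinate, for each distance between tails. -/
def firstKernel (s : ℝ) : Fin (4 + 1) → ℝ := ![s, -1, s, -1, s]

/-! ### The scheme carried by a tight family -/

variable {m q : ℕ} {Y : Type*} [Fintype Y]

/-- A family `w` of words of length `m + 1` that is a tight `4`-design, where `ρ₁` and `ρ₂` are the
zeros of the sum of the first three Krawtchouk polynomials. -/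
structure IsTightFamily (w : Y → Fin (m + 1) → Fin q) (ρ₁ ρ₂ : ℝ) : Prop where
  two_le_q : 2 ≤ q
  two_le_m : 2 ≤ m
  balanced : IsBalanced 4 w
  card : Fintype.card Y = ∑ k ∈ Finset.range 3, (m + 1).choose k * (q - 1) ^ k
  one_lt : 1 < ρ₁
  add_one_lt : ρ₁ + 1 < ρ₂
  sum_krawtchouk : ∀ x : ℝ, ∑ j ∈ Finset.range 3, krawtchouk (m + 1) q j x =
    (q : ℝ) ^ 2 / 2 * ((x - ρ₁) * (x - ρ₂))

namespace IsTightFamily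

variable {w : Y → Fin (m + 1) → Fin q} {ρ₁ ρ₂ : ℝ}

/-- The relations given by the distances between tails. -/
def rel (w : Y → Fin (m + 1) → Fin q) (ρ₁ ρ₂ : ℝ) (i : Fin (4 + 1)) (x y : Y) : Prop :=
  (hammingDist (Fin.tail (w x)) (Fin.tail (w y)) : ℝ) = tailDist ρ₁ ρ₂ i

theorem tailDist_injective (h : IsTightFamily w ρ₁ ρ₂) :
    Function.Injective (tailDist ρ₁ ρ₂) := by
  have h1 := h.one_lt
  have h2 := h.add_one_lt
  intro i j hij
  fin_cases i <;> fin_cases j <;> simp [tailDist] at hij ⊢ <;> linarith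

theorem rel_unique (h : IsTightFamily w ρ₁ ρ₂) (x y : Y) (i j : Fin (4 + 1))
    (hi : rel w ρ₁ ρ₂ i x y) (hj : rel w ρ₁ ρ₂ j x y) : i = j :=
  h.tailDist_injective (hi.symm.trans hj)

theorem one_lt_m (h : IsTightFamily w ρ₁ ρ₂) : (1 : ℝ) < m := by
  exact_mod_cast h.two_le_m

theorem q_sub_one_pos (h : IsTightFamily w ρ₁ ρ₂) : 0 < (q : ℝ) - 1 :=
  sub_pos.mpr (by exact_mod_cast h.two_le_q)

/-- The second eigenmatrix of the scheme. -/
noncomputable def eigenmatrix (m q : ℕ) (ρ₁ ρ₂ : ℝ) :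
    Matrix (Fin (4 + 1)) (Fin (4 + 1)) ℝ :=
  Matrix.of fun j i => eigenvalue m ((q : ℝ) - 1) (m * ((q : ℝ) - 1) - q * tailDist ρ₁ ρ₂ j)
    (firstKernel ((q : ℝ) - 1) j) i

/-- The three alternatives are: first coordinates differ (tail distance ρ - 1), they agree (tail
distance ρ), and the diagonal. The quadratic conditions say that ρ is a zero of the Krawtchouk sum.
-/
theorem isAdmissible (h : IsTightFamily w ρ₁ ρ₂) (j : Fin (4 + 1)) :
    IsAdmissible m ((q : ℝ) - 1) (m * ((q : ℝ) - 1) - q * tailDist ρ₁ ρ₂ j)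
      (firstKernel ((q : ℝ) - 1) j) := by
  have h1 := h.sum_krawtchouk ρ₁
  have h2 := h.sum_krawtchouk ρ₂
  simp only [Finset.sum_range_succ, Finset.range_zero, Finset.sum_empty, krawtchouk_zero,
    krawtchouk_one, krawtchouk_two, sub_self, zero_mul, mul_zero] at h1 h2
  push_cast at h1 h2
  fin_cases j
  · exact Or.inr (Or.inr ⟨rfl, by simp [tailDist]⟩)
  · refine Or.inl ⟨rfl, ?_⟩
    simp [tailDist]
    linear_combination 2 * h1
  · refine Or.inr (Or.inl ⟨rfl, ?_⟩)
    simp [tailDist]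
    linear_combination 2 * h1
  · refine Or.inl ⟨rfl, ?_⟩
    simp [tailDist]
    linear_combination 2 * h2
  · refine Or.inr (Or.inl ⟨rfl, ?_⟩)
    simp [tailDist]
    linear_combination 2 * h2

variable [Nonempty Y]

theorem hammingDist_eq (h : IsTightFamily w ρ₁ ρ₂) {x y : Y} (hxy : x ≠ y) :
    (hammingDist (w x) (w y) : ℝ) = ρ₁ ∨ (hammingDist (w x) (w y) : ℝ) = ρ₂ := by
  have hq := h.two_le_q
  have h0 := h.balanced.sum_krawtchouk_hammingDist (by omega) h.card hxy
  rw [h.sum_krawtchouk] at h0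
  have hq' : (q : ℝ) ^ 2 / 2 ≠ 0 := by positivity
  rcases mul_eq_zero.mp ((mul_eq_zero.mp h0).resolve_left hq') with h1 | h1
  · exact Or.inl (sub_eq_zero.mp h1)
  · exact Or.inr (sub_eq_zero.mp h1)

theorem tail_injective (h : IsTightFamily w ρ₁ ρ₂) :
    Function.Injective fun y => Fin.tail (w y) := by
  intro x y hxy
  by_contra hne
  have h1 : hammingDist (w x) (w y) ≤ 1 := by
    rw [hammingDist_eq_add_tail, show Fin.tail (w x) = Fin.tail (w y) from hxy, hammingDist_self]
    split_ifs <;> simp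
  have h1' : (hammingDist (w x) (w y) : ℝ) ≤ 1 := by exact_mod_cast h1
  have h2 := h.one_lt
  have h3 := h.add_one_lt
  rcases h.hammingDist_eq hne with h4 | h4 <;> linarith

theorem exists_rel_and_phi (h : IsTightFamily w ρ₁ ρ₂) (x y : Y) :
    ∃ i, rel w ρ₁ ρ₂ i x y ∧ phi (w x 0) (w y 0) = firstKernel ((q : ℝ) - 1) i := by
  by_cases hxy : x = y
  · subst hxy
    exact ⟨0, by simp [rel, tailDist], by simp [phi_self, firstKernel]⟩
  · have hd := h.hammingDist_eq hxy
    rw [hammingDist_eq_add_tail (w x) (w y)] at hd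
    by_cases h0 : w x 0 = w y 0
    · rw [if_pos h0, zero_add] at hd
      rcases hd with hd | hd
      · exact ⟨2, hd, by rw [h0, phi_self]; rfl⟩
      · exact ⟨4, hd, by rw [h0, phi_self]; rfl⟩
    · rw [if_neg h0, Nat.cast_add, Nat.cast_one] at hd
      rcases hd with hd | hd
      · exact ⟨1, by simp [rel, tailDist]; linarith, by rw [phi_of_ne h0]; rfl⟩
      · exact ⟨3, by simp [rel, tailDist]; linarith, by rw [phi_of_ne h0]; rfl⟩

theorem exists_rel (h : IsTightFamily w ρ₁ ρ₂) (x y : Y) : ∃ i, rel w ρ₁ ρ₂ i x y :=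
  (h.exists_rel_and_phi x y).imp fun _ => And.left

/-- The five tail distances are distinct, so the tails alone remember whether the deleted
coordinates agree. This puts the idempotents involving the first coordinate into the span of the
tail relations. -/
theorem phi_of_rel (h : IsTightFamily w ρ₁ ρ₂) {x y : Y} {i : Fin (4 + 1)}
    (hi : rel w ρ₁ ρ₂ i x y) : phi (w x 0) (w y 0) = firstKernel ((q : ℝ) - 1) i := by
  obtain ⟨j, hj, hφ⟩ := h.exists_rel_and_phi x y
  rw [h.rel_unique x y i j hi hj, hφ]

theorem tightIdem_apply_of_rel (h : IsTightFamily w ρ₁ ρ₂) (i : Fin (4 + 1)) {x y : Y}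
    {j : Fin (4 + 1)} (hj : rel w ρ₁ ρ₂ j x y) :
    tightIdem w i x y = (Fintype.card Y : ℝ)⁻¹ * eigenmatrix m q ρ₁ ρ₂ j i := by
  rw [tightIdem_apply, h.phi_of_rel hj, hj]
  rfl

theorem isSecondEigenmatrix (h : IsTightFamily w ρ₁ ρ₂) :
    IsSecondEigenmatrix (rel w ρ₁ ρ₂) (tightIdem w) (eigenmatrix m q ρ₁ ρ₂) := by
  intro i
  rw [Finset.smul_sum]
  simp only [smul_smul]
  exact eq_sum_smul_adj h.exists_rel h.rel_unique fun x y j hj => h.tightIdem_apply_of_rel i hj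

theorem tightIdem_mem (h : IsTightFamily w ρ₁ ρ₂) (i : Fin (4 + 1)) :
    tightIdem w i ∈ boseMesner (rel w ρ₁ ρ₂) := by
  rw [h.isSecondEigenmatrix i]
  exact Submodule.smul_mem _ _ (Submodule.sum_mem _ fun j _ =>
    Submodule.smul_mem _ _ (Submodule.subset_span ⟨j, rfl⟩))

/-- With s = q - 1, the diagonal entries times |Y| are 1, ms, m(m - 1)s²/2, ms² and s. -/
theorem tightIdem_ne_zero (h : IsTightFamily w ρ₁ ρ₂) (i : Fin (4 + 1)) :
    tightIdem w i ≠ 0 := by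
  have x := Classical.arbitrary Y
  intro h0
  have h1 := congrFun (congrFun h0 x) x
  rw [tightIdem_apply, hammingDist_self, phi_self, Matrix.zero_apply] at h1
  have h2 := (mul_eq_zero.mp h1).resolve_left
    (inv_ne_zero (Nat.cast_ne_zero.mpr Fintype.card_ne_zero))
  have hm := h.one_lt_m
  have hs := h.q_sub_one_pos
  have hms : (m : ℝ) * ((q : ℝ) - 1) ≠ 0 := (mul_pos (by linarith) hs).ne'
  have hms' : (m : ℝ) * ((m : ℝ) - 1) * ((q : ℝ) - 1) ^ 2 ≠ 0 :=
    (mul_pos (mul_pos (by linarith) (by linarith)) (pow_pos hs 2)).ne'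
  fin_cases i
  · simp [eigenvalue] at h2
  · exact hms (by simpa [eigenvalue] using h2)
  · refine hms' ?_
    simp only [eigenvalue, Fin.reduceFinMk, Matrix.cons_val] at h2
    push_cast at h2
    linear_combination 2 * h2
  · refine mul_ne_zero hs.ne' hms ?_
    simpa [eigenvalue] using h2
  · exact hs.ne' (by simpa [eigenvalue] using h2)

theorem tightIdem_mul_tightIdem (h : IsTightFamily w ρ₁ ρ₂) (i j : Fin (4 + 1)) :
    tightIdem w i * tightIdem w j = if i = j then tightIdem w i else 0 :=
  h.balanced.tightIdem_mul_tightIdem (by have := h.two_le_q; omega) i j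

theorem isScheme [DecidableEq Y] (h : IsTightFamily w ρ₁ ρ₂) : IsScheme (rel w ρ₁ ρ₂) := by
  refine isScheme_of_orthogonal_idempotents h.exists_rel h.rel_unique ?_ ?_ h.tightIdem_ne_zero
    h.tightIdem_mem h.tightIdem_mul_tightIdem
  · intro x y
    rw [rel, show tailDist ρ₁ ρ₂ 0 = 0 from rfl, Nat.cast_eq_zero, hammingDist_eq_zero]
    exact h.tail_injective.eq_iff
  · intro i x y hi
    rwa [rel, hammingDist_comm]

theorem linearIndependent_tightIdem (h : IsTightFamily w ρ₁ ρ₂) :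
    LinearIndependent ℝ (tightIdem w) :=
  linearIndependent_of_orthogonal_idempotents h.tightIdem_ne_zero h.tightIdem_mul_tightIdem

theorem isQPolynomial (h : IsTightFamily w ρ₁ ρ₂) :
    IsQPolynomial (rel w ρ₁ ρ₂) (tightIdem w) := by
  refine ⟨isIdempotentOrdering_of_orthogonal_idempotents h.tightIdem_ne_zero h.tightIdem_mem
    h.tightIdem_mul_tightIdem ?_, eigenmatrix m q ρ₁ ρ₂, h.isSecondEigenmatrix,
    dualPolynomial m ((q : ℝ) - 1), fun i =>
      ⟨degree_dualPolynomial h.one_lt_m h.q_sub_one_pos i, fun j =>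
        (h.isAdmissible j).eval_dualPolynomial h.one_lt_m h.q_sub_one_pos i⟩⟩
  ext x y
  rw [tightIdem_apply]
  simp [eigenvalue]

theorem hadamard_tightIdem (h : IsTightFamily w ρ₁ ρ₂) (i : Fin (4 + 1)) :
    tightIdem w 1 ⊙ tightIdem w i = (Fintype.card Y : ℝ)⁻¹ •
      ∑ l, kreinMatrix m ((q : ℝ) - 1) i l • tightIdem w l := by
  ext x y
  obtain ⟨j, hj⟩ := h.exists_rel x y
  have hk := (h.isAdmissible j).mul_eigenvalue i
  simp only [Matrix.hadamard_apply, Matrix.smul_apply, Matrix.sum_apply, smul_eq_mul,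
    h.tightIdem_apply_of_rel _ hj, mul_left_comm _ (Fintype.card Y : ℝ)⁻¹, ← Finset.mul_sum]
  rw [mul_assoc]
  exact congrArg _ (congrArg _ hk)

theorem exists_kreinArray (h : IsTightFamily w ρ₁ ρ₂) :
    ∃ κ, IsKrein (tightIdem w) κ ∧ IsQAntipodal κ ∧ ∀ n : ℝ, n = m + 1 →
      kreinB κ = ![(n - 1) * (q - 1), (n - 2) * (q - 1), 2 * (q - 1), 1] ∧
      kreinC κ = ![1, 2, (n - 2) * (q - 1), (n - 1) * (q - 1)] := by
  obtain ⟨κ, hκ⟩ := exists_isKrein h.exists_rel h.rel_unique h.linearIndependent_tightIdem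
    h.tightIdem_mem
  have hκ1 : ∀ i, κ 1 i = kreinMatrix m ((q : ℝ) - 1) i := fun i =>
    hκ.eq_of_hadamard_eq h.linearIndependent_tightIdem (h.hadamard_tightIdem i)
  refine ⟨κ, hκ, ?_, ?_⟩
  · intro i hi
    simp only [kreinB, kreinC, hκ1]
    fin_cases i
    · rfl
    · rfl
    -- The exempt middle index: b₂* = 2(q - 1) while c₂* = 2.
    · exact absurd rfl hi
    · rfl
  · rintro n rfl
    constructor
    · funext i
      simp only [kreinB, hκ1]
      fin_cases i <;> simp [kreinMatrix]
      left; ring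
    · funext i
      simp only [kreinC, hκ1]
      fin_cases i <;> simp [kreinMatrix]
      left; ring

end IsTightFamily

end Hamming

/-! ### Transfer to the punctured design -/

namespace Hamming

open AssocScheme

variable {m q : ℕ}

theorem IsTightDesign.exists_isTightFamily (hq : 2 ≤ q) {C : Finset (Fin (m + 1) → Fin q)}
    (hC : IsTightDesign 2 C) :
    ∃ ρ₁ ρ₂, IsTightFamily (fun y : C => (y : Fin (m + 1) → Fin q)) ρ₁ ρ₂ := by
  have hm : 2 ≤ m := by have := hC.design.le; omega
  obtain ⟨ρ₁, ρ₂, h1, h2, h3⟩ := exists_zeros_sum_krawtchouk hm hq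
  exact ⟨ρ₁, ρ₂, hq, hm, hC.design.isBalanced (by omega), by rw [Fintype.card_coe, hC.card],
    h1, h2, h3⟩

theorem IsTightFamily.comp_equiv {Y Z : Type*} [Fintype Y] [Fintype Z]
    {w : Y → Fin (m + 1) → Fin q} {ρ₁ ρ₂ : ℝ} (h : IsTightFamily w ρ₁ ρ₂) (e : Z ≃ Y) :
    IsTightFamily (w ∘ e) ρ₁ ρ₂ :=
  { h with
    balanced := fun S hS hSt a => by
      rw [← h.balanced S hS hSt a]
      exact e.sum_comp fun y => ∏ k ∈ S, phi (a k) (w y k)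
    card := by rw [Fintype.card_congr e, h.card] }

theorem mem_tilde {C : Finset (Fin (m + 1) → Fin q)} {x : Fin m → Fin q} :
    x ∈ tilde C ↔ ∃ y ∈ C, Fin.tail y = x := by
  simp only [tilde, part, Finset.mem_biUnion, Finset.mem_univ, true_and, Finset.mem_filter]
  constructor
  · rintro ⟨a, ha⟩
    exact ⟨_, ha, Fin.tail_cons _ _⟩
  · rintro ⟨y, hy, rfl⟩
    exact ⟨y 0, by rwa [Fin.cons_self_tail]⟩

theorem exists_equiv_tilde {C : Finset (Fin (m + 1) → Fin q)}
    (h : Function.Injective fun y : C => Fin.tail (y : Fin (m + 1) → Fin q)) :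
    ∃ e : tilde C ≃ C, ∀ z, Fin.tail (e z : Fin (m + 1) → Fin q) = z := by
  let f : C → tilde C := fun y =>
    ⟨Fin.tail (y : Fin (m + 1) → Fin q), mem_tilde.mpr ⟨y, y.2, rfl⟩⟩
  have hf : Function.Bijective f := by
    refine ⟨fun x y hxy => h (congrArg Subtype.val hxy), fun z => ?_⟩
    obtain ⟨y, hy, hyz⟩ := mem_tilde.mp z.2
    exact ⟨⟨y, hy⟩, Subtype.ext hyz⟩
  refine ⟨(Equiv.ofBijective f hf).symm, fun z => ?_⟩
  exact congrArg Subtype.val ((Equiv.ofBijective f hf).apply_symm_apply z)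

/-- Distances between tails that equal a distance of the design are attained by the design. -/
theorem IsTightFamily.hammingDist_eq_of_tail {Y : Type*} [Fintype Y] [Nonempty Y]
    {w : Y → Fin (m + 1) → Fin q} {ρ₁ ρ₂ : ℝ} (h : IsTightFamily w ρ₁ ρ₂) {x y : Y} {ρ : ℝ}
    (hρ : ρ = ρ₁ ∨ ρ = ρ₂) (hd : (hammingDist (Fin.tail (w x)) (Fin.tail (w y)) : ℝ) = ρ) :
    x ≠ y ∧ (hammingDist (w x) (w y) : ℝ) = ρ := by
  have h1 := h.one_lt
  have h2 := h.add_one_lt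
  have hne : x ≠ y := by
    rintro rfl
    rw [hammingDist_self, Nat.cast_zero] at hd
    rcases hρ with h3 | h3 <;> linarith
  refine ⟨hne, ?_⟩
  -- If the first coordinates differed, the full distance would be ρ + 1, which is neither ρ₁ nor ρ₂
  -- because the gap exceeds 1.
  have h3 := h.hammingDist_eq hne
  rw [hammingDist_eq_add_tail] at h3 ⊢
  push_cast at h3 ⊢
  rw [hd] at h3 ⊢
  split_ifs at h3 ⊢ <;> rcases hρ with h4 | h4 <;> rcases h3 with h5 | h5 <;> linarith

end Hamming

open AssocScheme Hamming in
/-- With `n = m + 1`, for a tight `4`-design `C` in `H(n,q)`. -/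
theorem mainTheorem2 (m q : ℕ) (hq : 2 ≤ q) (C : Finset (Fin (m + 1) → Fin q))
    (hC : IsTightDesign 2 C) :
    ∃ α₁ α₂ : ℕ, α₁ < α₂ ∧ degreeSet C = {α₁, α₂} ∧
      (∀ x : ℝ, ∑ j ∈ Finset.range 3, krawtchouk (m + 1) q j x = 0 ↔ x = α₁ ∨ x = α₂) ∧
      IsScheme (tildeRel C α₁ α₂) ∧
      ∃ (E : Fin (4 + 1) → Matrix (tilde C) (tilde C) ℝ)
        (κ : Fin (4 + 1) → Fin (4 + 1) → Fin (4 + 1) → ℝ),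
        IsQPolynomial (tildeRel C α₁ α₂) E ∧ IsKrein E κ ∧ IsQAntipodal κ ∧
        ∀ n : ℝ, n = m + 1 →
          kreinB κ = ![(n - 1) * (q - 1), (n - 2) * (q - 1), 2 * (q - 1), 1] ∧
          kreinC κ = ![1, 2, (n - 2) * (q - 1), (n - 1) * (q - 1)] := by
  obtain ⟨ρ₁, ρ₂, hw⟩ := hC.exists_isTightFamily hq
  have : Nonempty C := hC.design.nonempty.coe_sort
  obtain ⟨e, he⟩ := exists_equiv_tilde hw.tail_injective
  have : Nonempty (tilde C) := e.nonempty
  have hv := hw.comp_equiv e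
  -- Integrality of the zeros: relations 2 and 4 are nonempty, so ρ₁ and ρ₂ are realized as Hamming
  -- distances in `C`.
  obtain ⟨x₁, y₁, h₁⟩ := hv.isScheme.nonempty 2
  obtain ⟨x₂, y₂, h₂⟩ := hv.isScheme.nonempty 4
  obtain ⟨hne₁, hd₁⟩ := hv.hammingDist_eq_of_tail (Or.inl rfl) h₁
  obtain ⟨hne₂, hd₂⟩ := hv.hammingDist_eq_of_tail (Or.inr rfl) h₂
  set α₁ := hammingDist (((fun y : C => (y : Fin (m + 1) → Fin q)) ∘ e) x₁)
    (((fun y : C => (y : Fin (m + 1) → Fin q)) ∘ e) y₁)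
  set α₂ := hammingDist (((fun y : C => (y : Fin (m + 1) → Fin q)) ∘ e) x₂)
    (((fun y : C => (y : Fin (m + 1) → Fin q)) ∘ e) y₂)
  have h1 := hw.one_lt
  have h2 := hw.add_one_lt
  subst hd₁ hd₂
  have h1' : 1 ≤ α₁ := by exact_mod_cast h1.le
  have h2' : α₁ + 1 < α₂ := by exact_mod_cast h2
  have hrel : IsTightFamily.rel ((fun y : C => (y : Fin (m + 1) → Fin q)) ∘ e) α₁ α₂ =
      tildeRel C α₁ α₂ := by
    funext i x y
    -- The natural-number subtractions do not truncate, since both distances are at least 1.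
    have hδ : tailDist α₁ α₂ i = ((![0, α₁ - 1, α₁, α₂ - 1, α₂] : Fin (4 + 1) → ℕ) i : ℝ) := by
      have h3 : ((α₁ - 1 : ℕ) : ℝ) = α₁ - 1 := by rw [Nat.cast_sub h1', Nat.cast_one]
      have h4 : ((α₂ - 1 : ℕ) : ℝ) = α₂ - 1 := by rw [Nat.cast_sub (by omega), Nat.cast_one]
      fin_cases i <;> simp [tailDist, h3, h4]
    simp only [IsTightFamily.rel, tildeRel, Function.comp_apply, he, hδ, Nat.cast_inj]
  refine ⟨α₁, α₂, by omega, ?_, ?_, hrel ▸ hv.isScheme, ?_⟩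
  · ext d
    constructor
    · rintro ⟨x, hx, y, hy, hxy, rfl⟩
      have h3 := hw.hammingDist_eq (x := ⟨x, hx⟩) (y := ⟨y, hy⟩) fun h => hxy (congrArg Subtype.val h)
      exact h3.imp (fun h => by exact_mod_cast h) fun h => by exact_mod_cast h
    · rintro (rfl | rfl)
      · exact ⟨e x₁, (e x₁).2, e y₁, (e y₁).2,
          fun h => hne₁ (e.injective (Subtype.ext h)), rfl⟩
      · exact ⟨e x₂, (e x₂).2, e y₂, (e y₂).2,
          fun h => hne₂ (e.injective (Subtype.ext h)), rfl⟩
  · intro x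
    have hq' : (q : ℝ) ^ 2 / 2 ≠ 0 := by positivity
    rw [hw.sum_krawtchouk, mul_eq_zero, or_iff_right hq', mul_eq_zero, sub_eq_zero, sub_eq_zero]
  · obtain ⟨κ, hκ⟩ := hv.exists_kreinArray
    exact ⟨_, κ, hrel ▸ hv.isQPolynomial, hκ⟩
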